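/- For $n\in\mathbb{N}_0$ and $\alpha\in\mathbb{C}$ let $$L_n^{(\alpha)}(z)=\frac{z^{-\alpha}e^{z}}{n!}\frac{d^n}{dz^n}\left(z^{n+\alpha}e^{-z}\right)=\sum_{k=0}^{n}\frac{(\alpha+k+1)_{n-k}}{k!\,(n-k)!}(-z)^k$$ be the associated Laguerre polynomial, where $(a)_j=a(a+1)\cdots(a+j-1)$ and $(a)_0=1$. For integers $m\ge 0$, $n\ge 1$ and $\mu\in\mathbb{C}$ define the polynomials $$T^{(\mu)}_{m,n}(z)=\det\left[\frac{d^{j+k}}{dz^{j+k}}L^{(\mu+1)}_{m+n}(z)\right]_{j,k=0}^{n-1},\qquad \widehat T^{(\mu)}_{m,n}(z)=\det\left[\frac{d^{j+k}}{dz^{j+k}}\left(L^{(\mu+1)}_{m+n}(-z)\right)\right]_{j,k=0}^{n-1}.$$ For $\boldsymbol\nu=(\nu_1,\nu_2,\nu_3)\in\mathbb{C}^3$, let $\mathrm{S_V}(\boldsymbol\nu)$ be the fifth Painlevé $\sigma$-equation (Jimbo–Miwa–Okamoto form) $$\left(z\frac{d^2\sigma}{dz^2}\right)^{2}=\left[2\left(\frac{d\sigma}{dz}\right)^{2}+(\nu_1+\nu_2+\nu_3-z)\frac{d\sigma}{dz}+\sigma\right]^2-4\,\frac{d\sigma}{dz}\prod_{j=1}^{3}\left(\frac{d\sigma}{dz}+\nu_j\right).$$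 **Theorem.** Let $m\ge 0$, $n\ge 1$ be integers and $\mu\in\mathbb{C}$. Then the following hold. 1. $T^{(\mu)}_{m,n}$ is not the zero polynomial, and the rational function $$\sigma_{m,n}(z)=z\frac{d}{dz}\ln T^{(\mu)}_{m,n}(z)-(m+1)n$$ (where $\frac{d}{dz}\ln T$ means $T'/T$) is a solution of $\mathrm{S_V}(\boldsymbol\nu)$ with $\boldsymbol\nu=(m+1,\,-n,\,m+n+\mu+1)$. 2. $\widehat T^{(\mu)}_{m,n}$ is not the zero polynomial, and the rational function $$\widehat\sigma_{m,n}(z)=z\frac{d}{dz}\ln \widehat T^{(\mu)}_{m,n}(z)-(m+1)n$$ is a solution of $\mathrm{S_V}(\boldsymbol\nu)$ with $\boldsymbol\nu=(-m-1,\,n,\,-m-n-\mu-1)$. Here a rational function is called a solution if it satisfies the equation at every $z\in\mathbb{C}$ that is not one of its poles. -/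

import Mathlib

open Polynomial

noncomputable section

/-- The associated Laguerre polynomial `L_n^{(α)}` with complex parameter `α`,
`∑_{k ≤ n} (-1)^k (α + k + 1)_{n - k} / (k! (n - k)!) z^k`. The lemma `laguerre_rodrigues` below
identifies it with the Rodrigues formula. -/
def laguerre (n : ℕ) (α : ℂ) : ℂ[X] :=
  ∑ k ∈ Finset.range (n + 1),
    C ((-1) ^ k * (ascPochhammer ℂ (n - k)).eval (α + k + 1) /
      ((k.factorial : ℂ) * ((n - k).factorial : ℂ))) * X ^ k

lemma hasDerivAt_cpow_slitPlane (β : ℂ) {z : ℂ} (hz : z ∈ Complex.slitPlane) :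
    HasDerivAt (fun w : ℂ => w ^ β) (β * z ^ (β - 1)) z := by
  simpa using HasDerivAt.cpow_const (c := β) (hasDerivAt_id z) hz

lemma iteratedDeriv_cpow_slitPlane (β : ℂ) (i : ℕ) {z : ℂ} (hz : z ∈ Complex.slitPlane) :
    iteratedDeriv i (fun w : ℂ => w ^ β) z =
      (ascPochhammer ℂ i).eval (β - i + 1) * z ^ (β - i) := by
  induction i generalizing z with
  | zero => simp
  | succ i ih =>
    have hev : iteratedDeriv i (fun w : ℂ => w ^ β) =ᶠ[nhds z]
        fun w => (ascPochhammer ℂ i).eval (β - i + 1) * w ^ (β - i) := by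
      filter_upwards [Complex.isOpen_slitPlane.mem_nhds hz] with w hw using ih hw
    rw [iteratedDeriv_succ, hev.deriv_eq,
      ((hasDerivAt_cpow_slitPlane (β - i) hz).const_mul _).deriv, ascPochhammer_succ_left]
    have h1 : β - ((i + 1 : ℕ) : ℂ) + 1 = β - i := by push_cast; ring
    have h2 : β - ((i + 1 : ℕ) : ℂ) = β - i - 1 := by push_cast; ring
    rw [h1, h2]
    simp only [eval_mul, eval_X, eval_comp, eval_add, eval_one]
    ring

/-- The Rodrigues formula
`L_n^{(α)}(z) = z^{-α} e^z / n! * d^n/dz^n (z^{n + α} e^{-z})` (principal branch). -/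
lemma laguerre_rodrigues (n : ℕ) (α : ℂ) {z : ℂ} (hz : z ∈ Complex.slitPlane) :
    (laguerre n α).eval z =
      z ^ (-α) * Complex.exp z / (n.factorial : ℂ) *
        iteratedDeriv n (fun w : ℂ => w ^ ((n : ℂ) + α) * Complex.exp (-w)) z := by
  have hz0 : z ≠ 0 := Complex.slitPlane_ne_zero hz
  have hf : ContDiffAt ℂ n (fun w : ℂ => w ^ ((n : ℂ) + α)) z := by
    have hd : DifferentiableOn ℂ (fun w : ℂ => w ^ ((n : ℂ) + α)) Complex.slitPlane :=
      fun w hw => (hasDerivAt_cpow_slitPlane _ hw).differentiableAt.differentiableWithinAt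
    exact (hd.contDiffOn Complex.isOpen_slitPlane).contDiffAt
      (Complex.isOpen_slitPlane.mem_nhds hz)
  have hg : ContDiffAt ℂ n (fun w : ℂ => Complex.exp (-w)) z := by fun_prop
  rw [iteratedDeriv_fun_mul hf hg, laguerre, eval_finsetSum, Finset.mul_sum,
    ← Finset.sum_range_reflect]
  refine Finset.sum_congr rfl fun i hi => ?_
  have hin : i ≤ n := Nat.lt_succ_iff.mp (Finset.mem_range.mp hi)
  obtain ⟨k, rfl⟩ := Nat.exists_eq_add_of_le hin
  have hexp : ∀ j : ℕ, iteratedDeriv j (fun w : ℂ => Complex.exp (-w)) z =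
      (-1) ^ j * Complex.exp (-z) := by
    intro j
    rw [iteratedDeriv_comp_neg, iteratedDeriv_eq_iterate, Complex.iter_deriv_exp, smul_eq_mul]
  have e1 : i + k + 1 - 1 - i = k := by omega
  have e2 : i + k - k = i := by omega
  have e3 : i + k - i = k := by omega
  have e4 : ((i + k : ℕ) : ℂ) + α - i = k + α := by push_cast; ring
  have hpow : z ^ ((k : ℂ) + α) = z ^ k * z ^ α := by
    rw [Complex.cpow_add _ _ hz0, Complex.cpow_natCast]
  have hch : (((i + k).choose i : ℕ) : ℂ) * (i.factorial * k.factorial) = (i + k).factorial := by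
    have := Nat.add_choose_mul_factorial_mul_factorial i k
    rw [← this, Nat.choose_symm_add]; push_cast; ring
  have h1 : (i.factorial : ℂ) ≠ 0 := Nat.cast_ne_zero.mpr (Nat.factorial_ne_zero _)
  have h2 : (k.factorial : ℂ) ≠ 0 := Nat.cast_ne_zero.mpr (Nat.factorial_ne_zero _)
  have h3 : ((i + k).factorial : ℂ) ≠ 0 := Nat.cast_ne_zero.mpr (Nat.factorial_ne_zero _)
  have h4 : z ^ α ≠ 0 := by simp [Complex.cpow_eq_zero_iff, hz0]
  have hcc : (((i + k).choose i : ℕ) : ℂ) = (i + k).factorial / (i.factorial * k.factorial) := by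
    field_simp; linear_combination hch
  rw [iteratedDeriv_cpow_slitPlane _ _ hz, hexp, e1, e2, e3, e4, hpow, Complex.cpow_neg,
    Complex.exp_neg, hcc]
  simp only [eval_mul, eval_C, eval_pow, eval_X]
  have h5 := Complex.exp_ne_zero z
  rw [add_comm (k : ℂ) α]
  field_simp

/-- The generalised Laguerre polynomial
`T_{m,n}^{(μ)}(z) = det [d^{j+k}/dz^{j+k} L_{m+n}^{(μ+1)}(z)]_{j,k=0}^{n-1}`. -/
def genLaguerre (m n : ℕ) (μ : ℂ) : ℂ[X] :=
  (Matrix.of fun j k : Fin n =>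
    derivative^[(j : ℕ) + (k : ℕ)] (laguerre (m + n) (μ + 1))).det

/-- The companion polynomial
`\hat T_{m,n}^{(μ)}(z) = det [d^{j+k}/dz^{j+k} (L_{m+n}^{(μ+1)}(-z))]_{j,k=0}^{n-1}`. -/
def genLaguerreHat (m n : ℕ) (μ : ℂ) : ℂ[X] :=
  (Matrix.of fun j k : Fin n =>
    derivative^[(j : ℕ) + (k : ℕ)] ((laguerre (m + n) (μ + 1)).comp (-X))).det

/-- The Jimbo–Miwa–Okamoto `σ`-form of the fifth Painlevé equation with parameters `ν`,
for the function `σ` at the point `z`. -/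
def SVEquationAt (ν : Fin 3 → ℂ) (σ : ℂ → ℂ) (z : ℂ) : Prop :=
  (z * deriv (deriv σ) z) ^ 2 =
    (2 * (deriv σ z) ^ 2 + (ν 0 + ν 1 + ν 2 - z) * deriv σ z + σ z) ^ 2 -
      4 * deriv σ z * ∏ j : Fin 3, (deriv σ z + ν j)

/-- The value of a rational function at `z` (its numerator over its denominator in lowest terms). -/
def ratValue (R : RatFunc ℂ) (z : ℂ) : ℂ := R.eval (RingHom.id ℂ) z

/-- `R` is a rational solution of the `σ`-equation: the equation holds at every point of `ℂ`
that is not a pole of `R`. -/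
def IsRationalSolutionSV (ν : Fin 3 → ℂ) (R : RatFunc ℂ) : Prop :=
  ∀ z : ℂ, R.denom.eval z ≠ 0 → SVEquationAt ν (ratValue R) z

/-- The rational function `z d/dz ln T(z) - c = z T'(z) / T(z) - c`; see `ratValue_logDerivSigma`
for its values. -/
def logDerivSigma (T : ℂ[X]) (c : ℂ) : RatFunc ℂ :=
  RatFunc.X * (algebraMap ℂ[X] (RatFunc ℂ) (derivative T) / algebraMap ℂ[X] (RatFunc ℂ) T) -
    RatFunc.C c

lemma ratValue_logDerivSigma (T : ℂ[X]) (c : ℂ) {z : ℂ} (hz : T.eval z ≠ 0) :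
    (logDerivSigma T c).denom.eval z ≠ 0 ∧
      ratValue (logDerivSigma T c) z = z * logDeriv (fun w => T.eval w) z - c := by
  have hT : T ≠ 0 := by rintro rfl; simp at hz
  have hTm : algebraMap ℂ[X] (RatFunc ℂ) T ≠ 0 := RatFunc.algebraMap_ne_zero hT
  have hR : logDerivSigma T c =
      algebraMap ℂ[X] (RatFunc ℂ) (X * derivative T - C c * T) /
        algebraMap ℂ[X] (RatFunc ℂ) T := by
    rw [logDerivSigma, ← RatFunc.algebraMap_X, ← RatFunc.algebraMap_C]
    simp only [map_sub, map_mul]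
    field_simp
  have hd : (logDerivSigma T c).denom.eval z ≠ 0 := by
    obtain ⟨q, hq⟩ : (logDerivSigma T c).denom ∣ T := by
      rw [hR]; exact RatFunc.denom_div_dvd _ _
    intro h0
    apply hz
    rw [hq, eval_mul, h0, zero_mul]
  refine ⟨hd, ?_⟩
  have hnd := (RatFunc.num_mul_eq_mul_denom_iff hT).mpr hR
  have hev := congrArg (fun p : ℂ[X] => p.eval z) hnd
  simp only [eval_mul, eval_sub, eval_X, eval_C] at hev
  rw [ratValue, RatFunc.eval, logDeriv_apply, Polynomial.deriv, eval₂_id, eval₂_id]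
  field_simp
  linear_combination hev

end

noncomputable section

section DoubleMinor
variable {ι K : Type*} [Fintype ι] [DecidableEq ι] [Field K]

/-- A `2 × 2` bordered determinant in terms of the `1 × 1` bordered ones. -/
lemma det_mul_det_fromBlocks_two {A : Matrix ι ι K} (hA : A.det ≠ 0)
    (B : Matrix ι (Fin 2) K) (C : Matrix (Fin 2) ι K) (D : Matrix (Fin 2) (Fin 2) K) :
    A.det * (Matrix.fromBlocks A B C D).det =
      (Matrix.fromBlocks A (B.submatrix id fun _ : Fin 1 => 0) (C.submatrix (fun _ : Fin 1 => 0) id)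
          (D.submatrix (fun _ => 0) fun _ => 0)).det *
        (Matrix.fromBlocks A (B.submatrix id fun _ : Fin 1 => 1)
          (C.submatrix (fun _ : Fin 1 => 1) id) (D.submatrix (fun _ => 1) fun _ => 1)).det -
      (Matrix.fromBlocks A (B.submatrix id fun _ : Fin 1 => 1) (C.submatrix (fun _ : Fin 1 => 0) id)
          (D.submatrix (fun _ => 0) fun _ => 1)).det *
        (Matrix.fromBlocks A (B.submatrix id fun _ : Fin 1 => 0)
          (C.submatrix (fun _ : Fin 1 => 1) id) (D.submatrix (fun _ => 1) fun _ => 0)).det := by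
  have : Invertible A.det := invertibleOfNonzero hA
  have : Invertible A := Matrix.invertibleOfDetInvertible A
  simp only [Matrix.det_fromBlocks₁₁, Matrix.det_fin_two, Matrix.det_fin_one, Matrix.sub_apply,
    Matrix.mul_apply, Matrix.submatrix_apply, id]
  ring

end DoubleMinor

section HankelDet
variable {ι κ R : Type*} [Fintype ι] [DecidableEq ι] [Fintype κ] [DecidableEq κ] [CommRing R]

/-- The minor with rows `r` and columns `s` of the infinite Hankel matrix of the derivatives
of `φ`. -/
def derivMinor (φ : R[X]) (r s : ι → ℕ) : R[X] :=
  (Matrix.of fun i j => derivative^[r i + s j] φ).det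

lemma derivMinor_comm (φ : R[X]) (r s : ι → ℕ) : derivMinor φ r s = derivMinor φ s r := by
  rw [derivMinor, ← Matrix.det_transpose]
  simp only [derivMinor, Matrix.transpose, Matrix.of_apply, add_comm]

lemma derivMinor_comp_equiv (φ : R[X]) (r s : ι → ℕ) (e : κ ≃ ι) :
    derivMinor φ (r ∘ e) (s ∘ e) = derivMinor φ r s :=
  Matrix.det_submatrix_equiv_self e (Matrix.of fun i j => derivative^[r i + s j] φ)

lemma derivMinor_eq_zero (φ : R[X]) {r : ι → ℕ} (s : ι → ℕ) {i j : ι} (hij : i ≠ j)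
    (h : r i = r j) : derivMinor φ r s = 0 :=
  Matrix.det_zero_of_row_eq hij (by ext1 k; simp [h])

lemma derivative_derivMinor (φ : R[X]) (r s : ι → ℕ) :
    derivative (derivMinor φ r s) = ∑ i, derivMinor φ (Function.update r i (r i + 1)) s := by
  simp only [derivMinor, Matrix.det_apply, derivative_sum]
  rw [Finset.sum_comm]
  refine Finset.sum_congr rfl fun σ _ => ?_
  rw [← Finset.smul_sum, Units.smul_def, derivative_smul, ← Units.smul_def, derivative_prod_finset]
  congr 1
  refine (Finset.sum_congr rfl fun i _ => ?_).trans (Equiv.sum_comp σ _)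
  rw [← Finset.prod_erase_mul _ _ (Finset.mem_univ i)]
  congr 1
  · refine Finset.prod_congr rfl fun k hk => ?_
    have : σ k ≠ σ i := fun h => Finset.ne_of_mem_erase hk (σ.injective h)
    simp [Function.update_of_ne this]
  · simp only [Matrix.of_apply, Function.update_self]
    rw [← Function.iterate_succ_apply' (⇑derivative), add_right_comm]

/-- The Hankel determinant of order `n` of the derivatives of `φ`. -/
def hankelDet (φ : R[X]) (n : ℕ) : R[X] :=
  derivMinor φ (fun i : Fin n => (i : ℕ)) fun i => (i : ℕ)

/-- The indices `0, …, n - 1` together with `r`. -/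
def borderIdx (n r : ℕ) : Fin n ⊕ Fin 1 → ℕ := Sum.elim (fun i => (i : ℕ)) fun _ => r

lemma hankelDet_succ (φ : R[X]) (n : ℕ) :
    hankelDet φ (n + 1) = derivMinor φ (borderIdx n n) (borderIdx n n) := by
  rw [hankelDet, ← derivMinor_comp_equiv _ _ _ finSumFinEquiv]
  have : (fun i : Fin (n + 1) => (i : ℕ)) ∘ finSumFinEquiv = borderIdx n n := by
    ext (i | i)
    · simp [borderIdx]
    · simp [borderIdx]
  rw [this]

lemma derivative_derivMinor_borderIdx (φ : R[X]) (n : ℕ) (s : Fin n ⊕ Fin 1 → ℕ) :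
    derivative (derivMinor φ (borderIdx n n) s) = derivMinor φ (borderIdx n (n + 1)) s := by
  rw [derivative_derivMinor, Fintype.sum_sum_type, Finset.sum_eq_zero, zero_add,
    Fintype.sum_unique]
  · congr 1
    ext (i | i)
    · rw [Function.update_of_ne (by simp)]; rfl
    · rw [Subsingleton.elim i default, Function.update_self]; rfl
  · intro i _
    by_cases hi : (i : ℕ) + 1 < n
    · have hne : (Sum.inl ⟨i + 1, hi⟩ : Fin n ⊕ Fin 1) ≠ Sum.inl i := by simp [Fin.ext_iff]
      refine derivMinor_eq_zero φ s hne ?_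
      rw [Function.update_of_ne hne, Function.update_self]; rfl
    · have hne : (Sum.inr 0 : Fin n ⊕ Fin 1) ≠ Sum.inl i := by simp
      refine derivMinor_eq_zero φ s hne ?_
      rw [Function.update_of_ne hne, Function.update_self]
      have := i.2
      simp only [borderIdx, Sum.elim_inr, Sum.elim_inl]; omega

lemma derivative_hankelDet_succ (φ : R[X]) (n : ℕ) :
    derivative (hankelDet φ (n + 1)) = derivMinor φ (borderIdx n (n + 1)) (borderIdx n n) := by
  rw [hankelDet_succ, derivative_derivMinor_borderIdx]

lemma derivative_derivative_hankelDet_succ (φ : R[X]) (n : ℕ) :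
    derivative (derivative (hankelDet φ (n + 1))) =
      derivMinor φ (borderIdx n (n + 1)) (borderIdx n (n + 1)) := by
  rw [derivative_hankelDet_succ, derivMinor_comm, derivative_derivMinor_borderIdx]

lemma map_derivMinor {K : Type*} [Field K] (f : R[X] →+* K) (φ : R[X]) (r s : ι → ℕ) :
    f (derivMinor φ r s) = (Matrix.of fun i j => f (derivative^[r i + s j] φ)).det := by
  rw [derivMinor, RingHom.map_det]; rfl

lemma map_derivMinor_borderIdx {K : Type*} [Field K] (f : R[X] →+* K) (φ : R[X]) (n r s : ℕ) :
    f (derivMinor φ (borderIdx n r) (borderIdx n s)) =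
      (Matrix.fromBlocks (Matrix.of fun i j : Fin n => f (derivative^[(i : ℕ) + j] φ))
        (Matrix.of fun (i : Fin n) (_ : Fin 1) => f (derivative^[i + s] φ))
        (Matrix.of fun (_ : Fin 1) (j : Fin n) => f (derivative^[r + j] φ))
        (Matrix.of fun _ _ : Fin 1 => f (derivative^[r + s] φ))).det := by
  rw [map_derivMinor]
  congr 1
  ext (i | i) (j | j) <;> rfl

lemma map_hankelDet_add_two {K : Type*} [Field K] (f : R[X] →+* K) (φ : R[X]) (n : ℕ) :
    f (hankelDet φ (n + 2)) =
      (Matrix.fromBlocks (Matrix.of fun i j : Fin n => f (derivative^[(i : ℕ) + j] φ))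
        (Matrix.of fun (i : Fin n) (k : Fin 2) => f (derivative^[i + (n + k)] φ))
        (Matrix.of fun (k : Fin 2) (j : Fin n) => f (derivative^[n + k + j] φ))
        (Matrix.of fun k l : Fin 2 => f (derivative^[n + k + (n + l)] φ))).det := by
  rw [hankelDet, ← derivMinor_comp_equiv _ _ _ finSumFinEquiv, map_derivMinor]
  congr 1
  ext (i | i) (j | j) <;>
    simp only [Matrix.of_apply, Function.comp_apply, finSumFinEquiv_apply_left,
      finSumFinEquiv_apply_right, Fin.val_castAdd, Fin.val_natAdd, Matrix.fromBlocks_apply₁₁,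
      Matrix.fromBlocks_apply₁₂, Matrix.fromBlocks_apply₂₁, Matrix.fromBlocks_apply₂₂]

lemma map_hankelDet_toda {K : Type*} [Field K] (f : R[X] →+* K) (φ : R[X]) (n : ℕ)
    (hn : f (hankelDet φ n) ≠ 0) :
    f (hankelDet φ n) * f (hankelDet φ (n + 2)) =
      f (hankelDet φ (n + 1)) * f (derivative (derivative (hankelDet φ (n + 1)))) -
        f (derivative (hankelDet φ (n + 1))) ^ 2 := by
  have hA := map_derivMinor f φ (fun i : Fin n => (i : ℕ)) fun i => (i : ℕ)
  rw [hankelDet, hA] at hn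
  have h := det_mul_det_fromBlocks_two hn
    (Matrix.of fun (i : Fin n) (k : Fin 2) => f (derivative^[i + (n + k)] φ))
    (Matrix.of fun (k : Fin 2) (j : Fin n) => f (derivative^[n + k + j] φ))
    (Matrix.of fun k l : Fin 2 => f (derivative^[n + k + (n + l)] φ))
  have h11 := map_derivMinor_borderIdx f φ n (n + 1) (n + 1)
  have h10 := map_derivMinor_borderIdx f φ n (n + 1) n
  have h01 := map_derivMinor_borderIdx f φ n n (n + 1)
  have h00 := map_derivMinor_borderIdx f φ n n n
  rw [derivative_derivative_hankelDet_succ, derivative_hankelDet_succ, sq]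
  nth_rewrite 3 [derivMinor_comm]
  rw [mul_comm (f (derivMinor φ (borderIdx n (n + 1)) (borderIdx n n))), hankelDet_succ φ n,
    h11, h10, h01, h00, map_hankelDet_add_two, hankelDet, hA]
  exact h

/-- The Toda equation in bilinear form. -/
lemma hankelDet_toda [IsDomain R] (φ : R[X]) (n : ℕ) (hn : hankelDet φ n ≠ 0) :
    hankelDet φ n * hankelDet φ (n + 2) =
      hankelDet φ (n + 1) * derivative (derivative (hankelDet φ (n + 1))) -
        derivative (hankelDet φ (n + 1)) ^ 2 := by
  have hf : Function.Injective (algebraMap R[X] (FractionRing R[X])) :=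
    IsFractionRing.injective _ _
  apply hf
  rw [map_mul, map_sub, map_mul, map_pow]
  exact map_hankelDet_toda _ φ n ((map_ne_zero_iff _ hf).mpr hn)

lemma hankelDet_zero (φ : R[X]) : hankelDet φ 0 = 1 := Matrix.det_isEmpty

lemma hankelDet_one (φ : R[X]) : hankelDet φ 1 = φ := by
  simp [hankelDet, derivMinor]

lemma natDegree_mul_derivative_sub_sq {K : Type*} [Field K] [CharZero K] {P : K[X]} {d : ℕ}
    (hd : P.natDegree = d + 1) :
    P * derivative (derivative P) - derivative P ^ 2 ≠ 0 ∧
      (P * derivative (derivative P) - derivative P ^ 2).natDegree = 2 * d := by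
  have h1 : (derivative P).natDegree = d := by rw [natDegree_derivative, hd]; rfl
  have h2 : (derivative (derivative P)).natDegree = d - 1 := by rw [natDegree_derivative, h1]
  have hle : (P * derivative (derivative P) - derivative P ^ 2).natDegree ≤ 2 * d := by
    refine (natDegree_sub_le _ _).trans (max_le ?_ ?_)
    · rcases Nat.eq_zero_or_pos d with rfl | hpos
      · rw [derivative_of_natDegree_zero h1]; simp
      · refine natDegree_mul_le.trans ?_
        rw [hd, h2]; omega
    · refine natDegree_pow_le.trans ?_
      rw [h1]
  have hc : (P * derivative (derivative P) - derivative P ^ 2).coeff (2 * d) =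
      -(P.coeff (d + 1)) ^ 2 * (d + 1) := by
    have hsq : (derivative P ^ 2).coeff (2 * d) = (P.coeff (d + 1) * (d + 1)) ^ 2 := by
      rw [coeff_pow_of_natDegree_le h1.le, coeff_derivative]
    have hmul : (P * derivative (derivative P)).coeff (2 * d) =
        P.coeff (d + 1) * (P.coeff (d + 1) * (d + 1) * d) := by
      cases d with
      | zero => rw [derivative_of_natDegree_zero h1]; simp
      | succ e =>
        have : 2 * (e + 1) = (e + 1 + 1) + e := by ring
        rw [this, coeff_mul_add_eq_of_natDegree_le hd.le (by simpa using h2.le),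
          coeff_derivative, coeff_derivative]
        push_cast; ring
    rw [coeff_sub, hsq, hmul]; ring
  have hne : (P * derivative (derivative P) - derivative P ^ 2).coeff (2 * d) ≠ 0 := by
    rw [hc]
    have hP : P.coeff (d + 1) ≠ 0 := by
      rw [← hd]; exact leadingCoeff_ne_zero.mpr (by rintro rfl; simp at hd)
    exact mul_ne_zero (neg_ne_zero.mpr (pow_ne_zero 2 hP)) (Nat.cast_add_one_ne_zero d)
  exact ⟨fun h => hne (by rw [h, coeff_zero]), le_antisymm hle (le_natDegree_of_ne_zero hne)⟩

lemma natDegree_hankelDet {K : Type*} [Field K] [CharZero K] {φ : K[X]} (hφ : φ ≠ 0) (j k : ℕ)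
    (h : φ.natDegree + 1 = j + k) :
    hankelDet φ j ≠ 0 ∧ (hankelDet φ j).natDegree = j * k := by
  induction j using Nat.twoStepInduction generalizing k with
  | zero => simp [hankelDet_zero]
  | one => rw [hankelDet_one]; exact ⟨hφ, by omega⟩
  | more j ih1 ih2 =>
    obtain ⟨h1, d1⟩ := ih1 (k + 2) (by omega)
    obtain ⟨-, d2⟩ := ih2 (k + 1) (by omega)
    have ht := hankelDet_toda φ j h1
    obtain ⟨h3, d3⟩ := natDegree_mul_derivative_sub_sq (P := hankelDet φ (j + 1))
      (d := (j + 1) * k + j) (by rw [d2]; ring)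
    rw [← ht] at h3 d3
    have h4 := right_ne_zero_of_mul h3
    refine ⟨h4, ?_⟩
    rw [natDegree_mul h1 h4, d1] at d3
    linarith
end HankelDet

section Toda
variable {U : Set ℂ} {p β : ℕ → ℂ → ℂ} {a b : ℂ} {M : ℕ}

/-- Solutions of the Toda lattice, `p j` being the logarithmic derivative of the `j`-th tau
function and `β j` the derivative of `p j`, started from a logarithmic derivative `p 1` of a
solution of the confluent hypergeometric equation `z φ'' + (b - z) φ' - a φ = 0`. -/
structure ConfluentToda (U : Set ℂ) (p β : ℕ → ℂ → ℂ) (a b : ℂ) (M : ℕ) : Prop where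
  isOpen : IsOpen U
  zero_notMem : ∀ z ∈ U, z ≠ 0
  p_zero : ∀ z, p 0 z = 0
  β_zero : ∀ z, β 0 z = 0
  hasDerivAt_p : ∀ j ≤ M + 1, ∀ z ∈ U, HasDerivAt (p j) (β j z) z
  hasDerivAt_β : ∀ j ≤ M, ∀ z ∈ U,
    HasDerivAt (β j) (β j z * ((p (j + 1) z - p j z) - (p j z - p (j - 1) z))) z
  β_ne_zero : ∀ j ≤ M, 1 ≤ j → ∀ z ∈ U, β j z ≠ 0
  riccati : ∀ z ∈ U, z * (β 1 z + p 1 z ^ 2) + (b - z) * p 1 z - a = 0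

namespace ConfluentToda

/-- The first discrete string equation. -/
def stringOne (p β : ℕ → ℂ → ℂ) (a b : ℂ) (n : ℕ) (z : ℂ) : ℂ :=
  z * (β (n + 1) z + β n z + (p (n + 1) z - p n z) ^ 2 - (p (n + 1) z - p n z)) +
    (2 * n + b) * (p (n + 1) z - p n z) + 2 * p n z - 2 * n - a

/-- The second discrete string equation. -/
def stringTwo (p β : ℕ → ℂ → ℂ) (a b : ℂ) (n : ℕ) (z : ℂ) : ℂ :=
  z * β n z * (z * (p (n + 1) z - p (n - 1) z) - z + 2 * n + b - 2) -
    (2 * n + b - 2) * p n z + n * (n + a - 1)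

lemma eq_zero_of_hasDerivAt {U : Set ℂ} (hU : IsOpen U) {f : ℂ → ℂ} (hf : ∀ z ∈ U, f z = 0)
    {z f' : ℂ} (hz : z ∈ U) (h : HasDerivAt f f' z) : f' = 0 := by
  have h0 : HasDerivAt f 0 z :=
    (hasDerivAt_const z (0 : ℂ)).congr_of_eventuallyEq
      (by filter_upwards [hU.mem_nhds hz] with w hw using hf w hw)
  exact h.unique h0

lemma string_equations (h : ConfluentToda U p β a b M) (n : ℕ) (hn : n ≤ M) :
    (∀ z ∈ U, stringOne p β a b n z = 0) ∧ ∀ z ∈ U, stringTwo p β a b n z = 0 := by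
  induction n with
  | zero =>
    refine ⟨fun z hz => ?_, fun z hz => ?_⟩
    · have := h.riccati z hz
      simp only [stringOne, h.p_zero, h.β_zero, Nat.cast_zero]
      linear_combination this
    · simp [stringTwo, h.p_zero, h.β_zero]
  | succ n ih =>
    obtain ⟨ih1, ih2⟩ := ih (by omega)
    have h2 : ∀ z ∈ U, stringTwo p β a b (n + 1) z = 0 := by
      intro z hz
      have dp1 := h.hasDerivAt_p (n + 1) (by omega) z hz
      have dp := h.hasDerivAt_p n (by omega) z hz
      have dβ1 := h.hasDerivAt_β (n + 1) hn z hz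
      have dβ := h.hasDerivAt_β n (by omega) z hz
      have dα := dp1.sub dp
      have hd := eq_zero_of_hasDerivAt h.isOpen ih1 hz
        ((((((hasDerivAt_id z).mul (((dβ1.add dβ).add (dα.pow 2)).sub dα)).add
          (dα.const_mul (2 * (n : ℂ) + b))).add (dp.const_mul 2)).sub_const (2 * (n : ℂ))).sub_const
            a)
      have e1 := ih1 z hz
      have e2 := ih2 z hz
      simp only [id, Pi.add_apply, Pi.sub_apply, Pi.pow_apply, stringOne, stringTwo,
        Nat.add_sub_cancel] at hd e1 e2 ⊢
      push_cast at hd ⊢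
      linear_combination z * hd - e1 + e2
    refine ⟨fun z hz => ?_, h2⟩
    have hβ := h.β_ne_zero (n + 1) hn (by omega) z hz
    have dp2 := h.hasDerivAt_p (n + 1 + 1) (by omega) z hz
    have dp1 := h.hasDerivAt_p (n + 1) (by omega) z hz
    have dp := h.hasDerivAt_p n (by omega) z hz
    have dβ1 := h.hasDerivAt_β (n + 1) hn z hz
    have hd := eq_zero_of_hasDerivAt h.isOpen h2 hz
      (((((hasDerivAt_id z).mul dβ1).mul
        ((((((hasDerivAt_id z).mul (dp2.sub dp)).sub (hasDerivAt_id z)).add_const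
          (2 * ((n + 1 : ℕ) : ℂ))).add_const b).sub_const 2)).sub
            (dp1.const_mul (2 * ((n + 1 : ℕ) : ℂ) + b - 2))).add_const
              (((n + 1 : ℕ) : ℂ) * (((n + 1 : ℕ) : ℂ) + a - 1)))
    have e1 := ih1 z hz
    simp only [id, Pi.sub_apply, Pi.mul_apply, stringOne, Nat.add_sub_cancel]
      at hd e1 ⊢
    push_cast at hd ⊢
    have hzβ : z * β (n + 1) z ≠ 0 := mul_ne_zero (h.zero_notMem z hz) hβ
    refine mul_left_cancel₀ hzβ ?_
    linear_combination hd + z * β (n + 1) z * e1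

/-- The quadratic invariant attached to the singular point `0` of the associated linear system. -/
lemma quadratic_zero (h : ConfluentToda U p β a b M) (n : ℕ) (hn : n ≤ M) :
    ∀ z ∈ U, β n z * (z * (p (n + 1) z - p n z) + 2 * n + b - 1 - z) *
        (z * (p n z - p (n - 1) z) + 2 * n + b - 3 - z) =
      (p n z + z * β n z - n) * (p n z + z * β n z - n + 1 - a) := by
  induction n with
  | zero => intro z _; simp [h.p_zero, h.β_zero]
  | succ n ih =>
    intro z hz
    have e := ih (by omega) z hz
    have e1 := (h.string_equations n (by omega)).1 z hz
    have e2 := (h.string_equations n (by omega)).2 z hz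
    have e3 := (h.string_equations (n + 1) hn).2 z hz
    simp only [stringOne, stringTwo, Nat.add_sub_cancel] at e e1 e2 e3 ⊢
    push_cast at e3 ⊢
    refine mul_left_cancel₀ (h.zero_notMem z hz) ?_
    linear_combination z * e +
      (z * (p (n + 1) z - p n z) + 2 * n + b - 1 - z) * (e3 - e2) +
      (z * (p (n + 1) z - p n z) + 2 * n + b - 1 -
        z * (p (n + 1) z + z * β (n + 1) z - (p n z + z * β n z))) * e1

/-- The quadratic invariant attached to the singular point `1` of the associated linear system. -/
lemma quadratic_one (h : ConfluentToda U p β a b M) (n : ℕ) (hn : n ≤ M) :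
    ∀ z ∈ U, β n z * (z * (p (n + 1) z - p n z) + 2 * n + b - 1) *
        (z * (p n z - p (n - 1) z) + 2 * n + b - 3) =
      (p n z + z * β n z) * (p n z + z * β n z + b - a - 1) := by
  intro z hz
  have e := h.quadratic_zero n hn z hz
  have e2 := (h.string_equations n hn).2 z hz
  simp only [stringTwo] at e2
  linear_combination e + e2

/-- The `σ`-form of the fifth Painlevé equation for `σ = z p_n + n (a + n - 1)`, with
`σ' = p_n + z β_n`. -/
lemma sigma_form (h : ConfluentToda U p β a b M) (n : ℕ) (hn : n ≤ M) {z : ℂ} (hz : z ∈ U) :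
    (z * (2 * β n z + z * (β n z * ((p (n + 1) z - p n z) - (p n z - p (n - 1) z))))) ^ 2 =
      (2 * (p n z + z * β n z) ^ 2 + (b - 2 * a - 2 * n - z) * (p n z + z * β n z) +
        (z * p n z + n * (a + n - 1))) ^ 2 -
      4 * (p n z + z * β n z) * ((p n z + z * β n z + (1 - a - n)) * (p n z + z * β n z - n) *
        (p n z + z * β n z + (b - a - 1))) := by
  have e0 := h.quadratic_zero n hn z hz
  have e1 := h.quadratic_one n hn z hz
  set s := p n z + z * β n z with hs
  set θ := z * (p (n + 1) z - p n z) + 2 * n + b - 1 - z with hθ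
  set η := z * (p n z - p (n - 1) z) + 2 * n + b - 3 - z with hη
  have e1' : β n z * (θ + z) * (η + z) = s * (s + b - a - 1) := by
    rw [hθ, hη]; linear_combination e1
  have hsub : z * (2 * β n z + z * (β n z * ((p (n + 1) z - p n z) - (p n z - p (n - 1) z)))) =
      β n z * θ * (η + z) - β n z * η * (θ + z) := by
    rw [hθ, hη]; ring
  have hadd : 2 * s ^ 2 + (b - 2 * a - 2 * n - z) * s + (z * p n z + n * (a + n - 1)) =
      β n z * θ * (η + z) + β n z * η * (θ + z) := by
    linear_combination -e0 - e1' - z * hs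
  have hprod : s * ((s + (1 - a - n)) * (s - n) * (s + (b - a - 1))) =
      (β n z * θ * (η + z)) * (β n z * η * (θ + z)) := by
    linear_combination -(β n z * (θ + z) * (η + z)) * e0 -
      (s - n) * (s - n + 1 - a) * e1'
  rw [hsub, hadd, mul_assoc 4, hprod]
  ring

end ConfluentToda
end Toda

lemma coeff_laguerre (N : ℕ) (α : ℂ) (k : ℕ) (hk : k ≤ N) :
    (laguerre N α).coeff k = (-1) ^ k * (ascPochhammer ℂ (N - k)).eval (α + k + 1) /
      ((k.factorial : ℂ) * ((N - k).factorial : ℂ)) := by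
  simp only [laguerre, finsetSum_coeff, coeff_C_mul_X_pow]
  rw [Finset.sum_ite_eq]
  simp [Nat.lt_succ_of_le hk]

lemma coeff_laguerre_of_lt (N : ℕ) (α : ℂ) (k : ℕ) (hk : N < k) :
    (laguerre N α).coeff k = 0 := by
  simp only [laguerre, finsetSum_coeff, coeff_C_mul_X_pow]
  rw [Finset.sum_ite_eq]
  simp only [Finset.mem_range]
  rw [if_neg (by omega)]

lemma coeff_laguerre_succ (N : ℕ) (α : ℂ) (k : ℕ) :
    ((k : ℂ) + 1) * (k + α + 1) * (laguerre N α).coeff (k + 1) =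
      -((N : ℂ) - k) * (laguerre N α).coeff k := by
  rcases lt_trichotomy k N with hk | rfl | hk
  · obtain ⟨l, rfl⟩ := Nat.exists_eq_add_of_lt hk
    rw [coeff_laguerre _ _ _ (by omega), coeff_laguerre _ _ _ (by omega)]
    have e1 : k + l + 1 - (k + 1) = l := by omega
    have e2 : k + l + 1 - k = l + 1 := by omega
    have h1 : (k.factorial : ℂ) ≠ 0 := Nat.cast_ne_zero.mpr (Nat.factorial_ne_zero _)
    have h2 : (l.factorial : ℂ) ≠ 0 := Nat.cast_ne_zero.mpr (Nat.factorial_ne_zero _)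
    have h3 : (k : ℂ) + 1 ≠ 0 := Nat.cast_add_one_ne_zero k
    have h4 : (l : ℂ) + 1 ≠ 0 := Nat.cast_add_one_ne_zero l
    rw [e1, e2, ascPochhammer_succ_left, Nat.factorial_succ, Nat.factorial_succ]
    simp only [eval_mul, eval_X, eval_comp, eval_add, eval_one]
    push_cast
    have e3 : α + ((k : ℂ) + 1) + 1 = α + k + 1 + 1 := by ring
    rw [e3]
    field_simp
    ring
  · rw [coeff_laguerre_of_lt _ _ _ (by omega)]; ring
  · rw [coeff_laguerre_of_lt _ _ _ (by omega), coeff_laguerre_of_lt _ _ _ hk]; ring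

/-- Laguerre's differential equation. -/
lemma laguerre_ode (N : ℕ) (α : ℂ) :
    X * derivative (derivative (laguerre N α)) + (C (α + 1) - X) * derivative (laguerre N α) +
      C (N : ℂ) * laguerre N α = 0 := by
  ext k
  have h := coeff_laguerre_succ N α k
  rw [sub_mul]
  simp only [coeff_add, coeff_sub, coeff_C_mul, coeff_zero]
  cases k with
  | zero =>
    simp only [coeff_X_mul_zero, coeff_derivative]
    push_cast at h ⊢
    linear_combination h
  | succ k =>
    simp only [coeff_X_mul, coeff_derivative]
    push_cast at h ⊢
    linear_combination h

lemma coeff_laguerre_self_ne_zero (N : ℕ) (α : ℂ) : (laguerre N α).coeff N ≠ 0 := by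
  rw [coeff_laguerre _ _ _ le_rfl]
  simp [Nat.factorial_ne_zero]

lemma natDegree_laguerre (N : ℕ) (α : ℂ) : (laguerre N α).natDegree = N :=
  natDegree_eq_of_le_of_coeff_ne_zero
    (natDegree_le_iff_coeff_eq_zero.mpr fun k hk => coeff_laguerre_of_lt N α k hk)
    (coeff_laguerre_self_ne_zero N α)

lemma laguerre_ne_zero (N : ℕ) (α : ℂ) : laguerre N α ≠ 0 := fun h =>
  coeff_laguerre_self_ne_zero N α (by rw [h, coeff_zero])

lemma hankelDet_laguerre_ne_zero (N : ℕ) (α : ℂ) {j : ℕ} (hj : j ≤ N + 1) :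
    hankelDet (laguerre N α) j ≠ 0 :=
  (natDegree_hankelDet (laguerre_ne_zero N α) j (N + 1 - j)
    (by rw [natDegree_laguerre]; omega)).1

/-- The first derivative of `log T` at a point. -/
def polyLogDeriv (T : ℂ[X]) (z : ℂ) : ℂ := (derivative T).eval z / T.eval z

/-- The second derivative of `log T` at a point. -/
def polyLogDerivTwo (T : ℂ[X]) (z : ℂ) : ℂ :=
  (T * derivative (derivative T) - derivative T ^ 2).eval z / T.eval z ^ 2

lemma hasDerivAt_polyLogDeriv {T : ℂ[X]} {z : ℂ} (hz : T.eval z ≠ 0) :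
    HasDerivAt (polyLogDeriv T) (polyLogDerivTwo T z) z := by
  refine (((derivative T).hasDerivAt z).div (T.hasDerivAt z) hz).congr_deriv ?_
  simp only [polyLogDerivTwo, eval_sub, eval_mul, eval_pow]
  ring

lemma hasDerivAt_polyLogDerivTwo {T A B : ℂ[X]}
    (h : A * B = T * derivative (derivative T) - derivative T ^ 2) {z : ℂ} (hz : T.eval z ≠ 0)
    (hA : A.eval z ≠ 0) (hB : B.eval z ≠ 0) :
    HasDerivAt (polyLogDerivTwo T)
      (polyLogDerivTwo T z *
        ((polyLogDeriv B z - polyLogDeriv T z) - (polyLogDeriv T z - polyLogDeriv A z))) z := by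
  have hf : polyLogDerivTwo T = fun w => (A * B).eval w / T.eval w ^ 2 := by
    funext w; rw [polyLogDerivTwo, h]
  rw [hf]
  refine (((A * B).hasDerivAt z).div ((T.hasDerivAt z).pow 2) (pow_ne_zero 2 hz)).congr_deriv ?_
  simp only [polyLogDeriv, derivative_mul, eval_add, eval_mul, Pi.pow_apply]
  field_simp
  ring

/-- Off the roots of this polynomial the tau functions `τ_0, …, τ_{n + 1}` do not vanish. -/
def tauProduct (φ : ℂ[X]) (n : ℕ) : ℂ[X] := X * ∏ j ∈ Finset.range (n + 2), hankelDet φ j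

lemma eval_tauProduct_ne_zero {φ : ℂ[X]} {n : ℕ} {z : ℂ} (hz : (tauProduct φ n).eval z ≠ 0) :
    z ≠ 0 ∧ ∀ j ≤ n + 1, (hankelDet φ j).eval z ≠ 0 := by
  rw [tauProduct, eval_mul, eval_X, eval_prod] at hz
  exact ⟨left_ne_zero_of_mul hz, fun j hj =>
    Finset.prod_ne_zero_iff.mp (right_ne_zero_of_mul hz) j (Finset.mem_range.mpr (by omega))⟩

lemma confluentToda_laguerre (N : ℕ) (α : ℂ) (n : ℕ) (hn : n ≤ N) :
    ConfluentToda {z | (tauProduct (laguerre N α) n).eval z ≠ 0}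
      (fun j => polyLogDeriv (hankelDet (laguerre N α) j))
      (fun j => polyLogDerivTwo (hankelDet (laguerre N α) j)) (-N) (α + 1) n where
  isOpen := isOpen_ne_fun (Polynomial.continuous _) continuous_const
  zero_notMem z hz := (eval_tauProduct_ne_zero hz).1
  p_zero z := by simp [polyLogDeriv, hankelDet_zero]
  β_zero z := by simp [polyLogDerivTwo, hankelDet_zero]
  hasDerivAt_p j hj z hz := hasDerivAt_polyLogDeriv ((eval_tauProduct_ne_zero hz).2 j hj)
  hasDerivAt_β j hj z hz := by
    have hne := (eval_tauProduct_ne_zero hz).2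
    cases j with
    | zero =>
      have h0 : polyLogDerivTwo (hankelDet (laguerre N α) 0) = fun _ => 0 := by
        funext w; simp [polyLogDerivTwo, hankelDet_zero]
      rw [h0, zero_mul]
      exact hasDerivAt_const z 0
    | succ j =>
      exact hasDerivAt_polyLogDerivTwo
        (hankelDet_toda _ j (hankelDet_laguerre_ne_zero N α (by omega)))
        (hne _ (by omega)) (hne _ (by omega)) (hne _ (by omega))
  β_ne_zero j hj hj1 z hz := by
    have hne := (eval_tauProduct_ne_zero hz).2
    obtain ⟨j, rfl⟩ := Nat.exists_eq_add_of_le' hj1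
    rw [polyLogDerivTwo, ← hankelDet_toda _ j (hankelDet_laguerre_ne_zero N α (by omega)),
      eval_mul]
    exact div_ne_zero (mul_ne_zero (hne _ (by omega)) (hne _ (by omega)))
      (pow_ne_zero 2 (hne _ (by omega)))
  riccati z hz := by
    have hne := (eval_tauProduct_ne_zero hz).2 1 (by omega)
    have ho := congrArg (eval z) (laguerre_ode N α)
    simp only [polyLogDeriv, polyLogDerivTwo, hankelDet_one] at hne ⊢
    simp only [eval_add, eval_sub, eval_mul, eval_X, eval_C, eval_zero, eval_pow] at ho ⊢
    field_simp
    linear_combination eval z (laguerre N α) * ho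

lemma ratValue_eq_div (R : RatFunc ℂ) (z : ℂ) : ratValue R z = R.num.eval z / R.denom.eval z := by
  rw [ratValue, RatFunc.eval, eval₂_id, eval₂_id]

lemma isRationalSolutionSV_of_generic {ν : Fin 3 → ℂ} {R : RatFunc ℂ} {Q : ℂ[X]} (hQ : Q ≠ 0)
    (h : ∀ z, Q.eval z ≠ 0 → SVEquationAt ν (ratValue R) z) : IsRationalSolutionSV ν R := by
  intro z hz
  have hV : IsOpen {w : ℂ | R.denom.eval w ≠ 0} :=
    isOpen_ne_fun (Polynomial.continuous _) continuous_const
  have hf : DifferentiableOn ℂ (ratValue R) {w : ℂ | R.denom.eval w ≠ 0} := by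
    rw [funext (ratValue_eq_div R)]
    exact fun w hw => ((R.num.differentiable w).div (R.denom.differentiable w)
      hw).differentiableWithinAt
  have hf1 := hf.deriv hV
  have hf2 := hf1.deriv hV
  have hm : {w : ℂ | R.denom.eval w ≠ 0} ∈ nhds z := hV.mem_nhds hz
  have c0 := (hf.differentiableAt hm).continuousAt
  have c1 := (hf1.differentiableAt hm).continuousAt
  have c2 := (hf2.differentiableAt hm).continuousAt
  have hfreq : ∃ᶠ w in nhds z, SVEquationAt ν (ratValue R) w := by
    have hfin : ({w : ℂ | Q.eval w = 0}).Finite := by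
      refine (Q.roots.toFinset.finite_toSet).subset fun w hw => ?_
      simpa [hQ] using hw
    have : ∀ᶠ w in nhdsWithin z {z}ᶜ, w ∉ {w : ℂ | Q.eval w = 0} \ {z} :=
      nhdsWithin_le_nhds ((hfin.subset Set.sdiff_subset).isClosed.isOpen_compl.mem_nhds (by simp))
    have hev : ∀ᶠ w in nhdsWithin z {z}ᶜ, SVEquationAt ν (ratValue R) w := by
      filter_upwards [this, self_mem_nhdsWithin] with w hw hwz
      exact h w fun h0 => hw ⟨h0, hwz⟩
    exact hev.frequently.filter_mono nhdsWithin_le_nhds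
  have hcont : ContinuousAt (fun w => (w * deriv (deriv (ratValue R)) w) ^ 2 -
      ((2 * (deriv (ratValue R) w) ^ 2 + (ν 0 + ν 1 + ν 2 - w) * deriv (ratValue R) w +
        ratValue R w) ^ 2 -
          4 * deriv (ratValue R) w * ∏ j : Fin 3, (deriv (ratValue R) w + ν j))) z := by
    simp only [Fin.prod_univ_three]; fun_prop
  by_contra hne
  obtain ⟨w, hw, hw'⟩ :=
    (hfreq.and_eventually (hcont.eventually_ne (sub_ne_zero.mpr hne))).exists
  exact hw' (sub_eq_zero.mpr hw)

/-- The first two derivatives of `z T' / T - c`. -/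
lemma deriv_ratValue_logDerivSigma {T : ℂ[X]} (c : ℂ) {z p'' : ℂ} (hz : T.eval z ≠ 0)
    (hp'' : HasDerivAt (polyLogDerivTwo T) p'' z) :
    ratValue (logDerivSigma T c) z = z * polyLogDeriv T z - c ∧
      deriv (ratValue (logDerivSigma T c)) z = polyLogDeriv T z + z * polyLogDerivTwo T z ∧
      deriv (deriv (ratValue (logDerivSigma T c))) z = 2 * polyLogDerivTwo T z + z * p'' := by
  have hV : IsOpen {w : ℂ | T.eval w ≠ 0} :=
    isOpen_ne_fun (Polynomial.continuous _) continuous_const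
  have h0 : ∀ w, T.eval w ≠ 0 → ratValue (logDerivSigma T c) w = w * polyLogDeriv T w - c := by
    intro w hw
    rw [(ratValue_logDerivSigma T c hw).2, logDeriv_apply, Polynomial.deriv]; rfl
  have h1 : ∀ w, T.eval w ≠ 0 →
      deriv (ratValue (logDerivSigma T c)) w = polyLogDeriv T w + w * polyLogDerivTwo T w := by
    intro w hw
    have he : ratValue (logDerivSigma T c) =ᶠ[nhds w] fun w => w * polyLogDeriv T w - c := by
      filter_upwards [hV.mem_nhds hw] with v hv using h0 v hv
    rw [he.deriv_eq]
    refine HasDerivAt.deriv ?_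
    refine (((hasDerivAt_id w).fun_mul (hasDerivAt_polyLogDeriv hw)).sub_const c).congr_deriv ?_
    simp
  refine ⟨h0 z hz, h1 z hz, ?_⟩
  have he : deriv (ratValue (logDerivSigma T c)) =ᶠ[nhds z]
      fun w => polyLogDeriv T w + w * polyLogDerivTwo T w := by
    filter_upwards [hV.mem_nhds hz] with v hv using h1 v hv
  rw [he.deriv_eq]
  refine HasDerivAt.deriv ?_
  refine ((hasDerivAt_polyLogDeriv hz).fun_add ((hasDerivAt_id z).fun_mul hp'')).congr_deriv ?_
  simp only [id]; ring

lemma genLaguerre_eq_hankelDet (m n : ℕ) (μ : ℂ) :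
    genLaguerre m n μ = hankelDet (laguerre (m + n) (μ + 1)) n := rfl

lemma derivative_iterate_comp_neg_X (f : ℂ[X]) (k : ℕ) :
    derivative^[k] (f.comp (-X)) = (-1) ^ k * (derivative^[k] f).comp (-X) := by
  induction k with
  | zero => simp
  | succ k ih =>
    rw [Function.iterate_succ_apply', ih, Function.iterate_succ_apply', derivative_mul,
      derivative_comp]
    have : derivative ((-1 : ℂ[X]) ^ k) = 0 := by
      rw [← C_1, ← C_neg, ← C_pow, derivative_C]
    rw [this]
    simp
    ring

lemma genLaguerreHat_eq_comp (m n : ℕ) (μ : ℂ) :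
    genLaguerreHat m n μ = (genLaguerre m n μ).comp (-X) := by
  have h : (genLaguerre m n μ).comp (-X) = (Matrix.of fun j k : Fin n =>
      (derivative^[(j : ℕ) + k] (laguerre (m + n) (μ + 1))).comp (-X)).det :=
    RingHom.map_det (compRingHom (-X)) (Matrix.of fun j k : Fin n =>
      derivative^[(j : ℕ) + k] (laguerre (m + n) (μ + 1)))
  have h2 : (Matrix.of fun j k : Fin n =>
      derivative^[(j : ℕ) + k] ((laguerre (m + n) (μ + 1)).comp (-X))) =
      Matrix.of fun j k : Fin n => (-1) ^ (j : ℕ) * (Matrix.of fun j k : Fin n => (-1) ^ (k : ℕ) *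
        (derivative^[(j : ℕ) + k] (laguerre (m + n) (μ + 1))).comp (-X)) j k := by
    ext1 j k
    simp only [Matrix.of_apply, derivative_iterate_comp_neg_X, pow_add, mul_assoc]
  rw [genLaguerreHat, h2, Matrix.det_mul_column, h]
  have h3 := Matrix.det_mul_row (fun k : Fin n => (-1 : ℂ[X]) ^ (k : ℕ))
    (Matrix.of fun j k : Fin n =>
    (derivative^[(j : ℕ) + k] (laguerre (m + n) (μ + 1))).comp (-X))
  simp only [Matrix.of_apply] at h3
  rw [h3, ← mul_assoc, ← Finset.prod_mul_distrib]
  simp [← mul_pow]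

lemma polyLogDeriv_comp_neg (T : ℂ[X]) (z : ℂ) :
    polyLogDeriv (T.comp (-X)) z = -polyLogDeriv T (-z) := by
  simp [polyLogDeriv, derivative_comp, neg_div]

lemma polyLogDerivTwo_comp_neg (T : ℂ[X]) (z : ℂ) :
    polyLogDerivTwo (T.comp (-X)) z = polyLogDerivTwo T (-z) := by
  simp [polyLogDerivTwo, derivative_comp]

lemma tauProduct_laguerre_ne_zero (N : ℕ) (α : ℂ) (n : ℕ) (hn : n ≤ N) :
    tauProduct (laguerre N α) n ≠ 0 :=
  mul_ne_zero X_ne_zero (Finset.prod_ne_zero_iff.mpr fun j hj =>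
    hankelDet_laguerre_ne_zero N α (by have := Finset.mem_range.mp hj; omega))

lemma comp_neg_X_ne_zero {f : ℂ[X]} (hf : f ≠ 0) : f.comp (-X) ≠ 0 := by
  intro h
  apply hf
  have := congrArg (fun g : ℂ[X] => g.comp (-X)) h
  simpa [comp_assoc] using this

theorem mainTheorem4 (m n : ℕ) (hn : 1 ≤ n) (μ : ℂ) :
    (genLaguerre m n μ ≠ 0 ∧
      IsRationalSolutionSV ![(m : ℂ) + 1, -(n : ℂ), (m : ℂ) + n + μ + 1]
        (logDerivSigma (genLaguerre m n μ) (((m : ℂ) + 1) * n))) ∧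
    (genLaguerreHat m n μ ≠ 0 ∧
      IsRationalSolutionSV ![-(m : ℂ) - 1, (n : ℂ), -(m : ℂ) - n - μ - 1]
        (logDerivSigma (genLaguerreHat m n μ) (((m : ℂ) + 1) * n))) := by
  have htoda := confluentToda_laguerre (m + n) (μ + 1) n (by omega)
  have hQ := tauProduct_laguerre_ne_zero (m + n) (μ + 1) n (by omega)
  have hT : genLaguerre m n μ ≠ 0 := hankelDet_laguerre_ne_zero (m + n) (μ + 1) (by omega)
  refine ⟨⟨hT, ?_⟩, ?_, ?_⟩
  · refine isRationalSolutionSV_of_generic hQ fun z hz => ?_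
    obtain ⟨s0, s1, s2⟩ := deriv_ratValue_logDerivSigma (((m : ℂ) + 1) * n)
      ((eval_tauProduct_ne_zero hz).2 n (by omega)) (htoda.hasDerivAt_β n le_rfl z hz)
    have key := htoda.sigma_form n le_rfl hz
    rw [SVEquationAt, genLaguerre_eq_hankelDet, s0, s1, s2]
    simp only [Fin.prod_univ_three, Matrix.cons_val] at key ⊢
    push_cast at key
    linear_combination key
  · rw [genLaguerreHat_eq_comp]
    exact comp_neg_X_ne_zero hT
  · refine isRationalSolutionSV_of_generic (comp_neg_X_ne_zero hQ) fun z hz => ?_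
    rw [eval_comp, eval_neg, eval_X] at hz
    have hd := htoda.hasDerivAt_β n le_rfl (-z) hz
    have hd' := HasDerivAt.scomp z hd (hasDerivAt_neg z)
    have hfun : polyLogDerivTwo (hankelDet (laguerre (m + n) (μ + 1)) n) ∘ Neg.neg =
        polyLogDerivTwo ((hankelDet (laguerre (m + n) (μ + 1)) n).comp (-X)) := by
      funext w; rw [polyLogDerivTwo_comp_neg]; rfl
    rw [hfun] at hd'
    obtain ⟨s0, s1, s2⟩ := deriv_ratValue_logDerivSigma (((m : ℂ) + 1) * n)
      (by rw [eval_comp, eval_neg, eval_X]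
          exact (eval_tauProduct_ne_zero hz).2 n (by omega)) hd'
    have key := htoda.sigma_form n le_rfl hz
    rw [polyLogDeriv_comp_neg] at s0 s1
    rw [polyLogDerivTwo_comp_neg] at s1 s2
    rw [SVEquationAt, genLaguerreHat_eq_comp, genLaguerre_eq_hankelDet, s0, s1, s2]
    simp only [Fin.prod_univ_three, Matrix.cons_val, smul_eq_mul] at key ⊢
    push_cast at key
    linear_combination key

end
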